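/- Let $T$ and $Y$ be nonempty sets and $\mathcal F$ an algebra of subsets of $Y$. For $n\ge 1$ let $\mathcal F^n$ be the product algebra on $Y^n$, generated by the rectangles $F_1\times\dots\times F_n$ with $F_i\in\mathcal F$; if $\mathcal F$ is a σ-algebra, $\mathcal F^n$ may throughout be read instead as the product σ-algebra. For a set $S$ with an algebra $\Sigma$, let $\mathcal P(S,\Sigma)$ be the set of finitely additive probability measures on $(S,\Sigma)$, with the weak* topology, i.e. the weakest topology making $p\mapsto\int f\,dp$ continuous for every bounded measurable $f:S\to\mathbb R$ (uniform limit of $\Sigma$-simple functions), and let $\mathcal P_\sigma(S,\Sigma)$ be the subset of σ-additive ones, with the relative topology. For a measurable map $X:(S_0,\Sigma_0)\to(S_1,\Sigma_1)$ let $\hat X(p)(F)=p(X^{-1}(F))$ denote the pushforward. For every $n\ge1$ and every sequence $t_1,\dots,t_n$ of distinct elements of $T$ let $V_{t_1,\dots,t_n}$ be a nonempty weak* closed subset of $\mathcal P(Y^n,\mathcal F^n)$. Consider the conditions 1. for all $n\ge1$, all distinct $t_1,\dots,t_n\in T$ and every permutation $\pi$ of $\{1,\dots,n\}$, with $f_\pi(y_1,\dots,y_n)=(y_{\pi(1)},\dots,y_{\pi(n)})$: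 for each $v_1\in V_{t_{\pi(1)},\dots,t_{\pi(n)}}$ there is $v_2\in V_{t_1,\dots,t_n}$ with $v_1(F)=v_2(f_\pi^{-1}(F))$ for all $F\in\mathcal F^n$; 2. for all $n\ge1$, $m\ge0$ and distinct $t_1,\dots,t_{n+m}\in T$: for each $v_1\in V_{t_1,\dots,t_{n+m}}$ there is $v_2\in V_{t_1,\dots,t_n}$ such that $v_1(F\times Y^m)=v_2(F)$ for all $F\in\mathcal F^n$, and for each $v_2\in V_{t_1,\dots,t_n}$ there is $v_1\in V_{t_1,\dots,t_{n+m}}$ such that the same equality holds. **Theorem 1.** The family $\{V_{t_1,\dots,t_n}\}$ satisfies conditions 1 and 2 if and only if there exist a set $\Omega$, a σ-algebra $\mathcal A$ on $\Omega$, a weak* closed set $P\subseteq\mathcal P(\Omega,\mathcal A)$ and maps $X_t:\Omega\to Y$ ($t\in T$) such that for all $n\ge1$ and all distinct $t_1,\dots,t_n\in T$ the map $[X_{t_1},\dots,X_{t_n}]:\Omega\to Y^n$ is measurable and $$\widehat{[X_{t_1},\dots,X_{t_n}]}(P)=V_{t_1,\dots,t_n}.\qquad(*)$$ Moreover, if conditions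 1 and 2 hold, $Y=\mathbb R$, $\mathcal F^n$ is the Borel σ-algebra $\mathcal B(\mathbb R^n)$, and every $V_{t_1,\dots,t_n}$ consists of σ-additive probability measures on $(\mathbb R^n,\mathcal B(\mathbb R^n))$, then $\Omega,\mathcal A,P,(X_t)$ can be chosen so that, in addition, there is a closed subset $P_\sigma$ of $\mathcal P_\sigma(\Omega,\mathcal A)$ for which $(*)$ holds with $P$ replaced by $P_\sigma$. -/

import Mathlib

universe u v w

/-- An algebra (field) of subsets of `S`. -/
structure SetAlg (S : Type*) where
  sets : Set (Set S)
  isSetAlgebra : MeasureTheory.IsSetAlgebra sets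

/-- A σ-algebra, seen as an algebra of sets. -/
def SetAlg.ofMeasurableSpace {S : Type*} (m : MeasurableSpace S) : SetAlg S where
  sets := {A | @MeasurableSet S m A}
  isSetAlgebra :=
    { empty_mem := MeasurableSet.empty
      compl_mem := fun _ h => MeasurableSet.compl h
      union_mem := fun _ _ hs ht => MeasurableSet.union hs ht }

/-- The product algebra on `Y ^ n`: the algebra generated by the rectangles
`F₁ × ⋯ × Fₙ` with sides in the algebra `𝓕`. -/
def SetAlg.pow {Y : Type*} (𝓕 : SetAlg Y) (n : ℕ) : SetAlg (Fin n → Y) where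
  sets := MeasureTheory.generateSetAlgebra
    {R | ∃ F : Fin n → Set Y, (∀ i, F i ∈ 𝓕.sets) ∧ R = Set.univ.pi F}
  isSetAlgebra := MeasureTheory.isSetAlgebra_generateSetAlgebra

/-- The product σ-algebra on `Y ^ n`, for a σ-algebra on `Y`. It is the smallest
σ-algebra for which the coordinates are measurable. -/
def SetAlg.sigmaPow {Y : Type*} (m : MeasurableSpace Y) (n : ℕ) : SetAlg (Fin n → Y) :=
  SetAlg.ofMeasurableSpace (MeasurableSpace.pi (m := fun _ => m))

/-- A finitely additive probability measure on `(S, 𝒜)`. It is a function on the sets of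
the algebra; sets outside the algebra get the value `0`, so that two measures are equal as soon
as they agree on the algebra. -/
structure FinAddProb {S : Type*} (𝒜 : SetAlg S) where
  toFun : Set S → ℝ
  nonneg' : ∀ A ∈ 𝒜.sets, 0 ≤ toFun A
  univ' : toFun Set.univ = 1
  union' : ∀ A ∈ 𝒜.sets, ∀ B ∈ 𝒜.sets, Disjoint A B → toFun (A ∪ B) = toFun A + toFun B
  off' : ∀ A, A ∉ 𝒜.sets → toFun A = 0

/-- Measurability of a map between two sets with algebras of subsets. -/
def IsMeasMap {S₀ S₁ : Type*} (𝒜 : SetAlg S₀) (ℬ : SetAlg S₁) (X : S₀ → S₁) : Prop :=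
  ∀ F ∈ ℬ.sets, X ⁻¹' F ∈ 𝒜.sets

namespace FinAddProb

instance {S : Type*} (𝒜 : SetAlg S) : CoeFun (FinAddProb 𝒜) (fun _ => Set S → ℝ) :=
  ⟨FinAddProb.toFun⟩

open Classical in
/-- The pushforward `q (F) = p (X ∈ F)` of a finitely additive probability measure. -/
noncomputable def map {S₀ S₁ : Type*} {𝒜 : SetAlg S₀} {ℬ : SetAlg S₁} (X : S₀ → S₁)
    (hX : IsMeasMap 𝒜 ℬ X) (p : FinAddProb 𝒜) : FinAddProb ℬ where
  toFun F := if F ∈ ℬ.sets then p (X ⁻¹' F) else 0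
  nonneg' F hF := by
    rw [if_pos hF]
    exact p.nonneg' _ (hX F hF)
  univ' := by
    rw [if_pos ℬ.isSetAlgebra.univ_mem]
    exact p.univ'
  union' A hA B hB hAB := by
    rw [if_pos hA, if_pos hB, if_pos (ℬ.isSetAlgebra.union_mem hA hB)]
    exact p.union' _ (hX A hA) _ (hX B hB) (hAB.preimage X)
  off' F hF := if_neg hF

/-- σ-additivity, for sequences of disjoint sets of the algebra whose union is in the algebra. -/
def IsSigmaAdditive {S : Type*} {𝒜 : SetAlg S} (p : FinAddProb 𝒜) : Prop :=
  ∀ A : ℕ → Set S, (∀ k, A k ∈ 𝒜.sets) → Pairwise (Function.onFun Disjoint A) →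
    (⋃ k, A k) ∈ 𝒜.sets → HasSum (fun k => p (A k)) (p (⋃ k, A k))

end FinAddProb

/-- Simple functions: finitely many values, each taken on a set of the algebra. -/
def IsSimpleFn {S : Type*} (𝒜 : SetAlg S) (s : S → ℝ) : Prop :=
  (Set.range s).Finite ∧ ∀ c : ℝ, s ⁻¹' {c} ∈ 𝒜.sets

/-- The bounded measurable functions of an algebra: the uniform limits of simple functions.
If the algebra is a σ-algebra, these are the bounded functions that are measurable in the
usual sense. -/
def IsBddMeas {S : Type*} (𝒜 : SetAlg S) (f : S → ℝ) : Prop :=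
  ∀ ε : ℝ, 0 < ε → ∃ s : S → ℝ, IsSimpleFn 𝒜 s ∧ ∀ x, |f x - s x| ≤ ε

/-- The integral of a simple function, `∑ c · p (s = c)` over the values `c` of `s`. -/
noncomputable def FinAddProb.simpleIntegral {S : Type*} {𝒜 : SetAlg S} (p : FinAddProb 𝒜)
    (s : S → ℝ) : ℝ :=
  ∑ᶠ c : ℝ, c * p (s ⁻¹' {c})

/-- The integral of a bounded measurable function with respect to a finitely additive
probability measure: the supremum of the integrals of the simple functions below it. -/
noncomputable def FinAddProb.integral {S : Type*} {𝒜 : SetAlg S} (p : FinAddProb 𝒜)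
    (f : S → ℝ) : ℝ :=
  sSup {r : ℝ | ∃ s : S → ℝ, IsSimpleFn 𝒜 s ∧ (∀ x, s x ≤ f x) ∧ r = p.simpleIntegral s}

/-- `V` is a subset of `K` that is closed in the relative weak* topology of `K`. -/
def IsWeakStarClosedIn {S : Type*} {𝒜 : SetAlg S} (K V : Set (FinAddProb 𝒜)) : Prop :=
  V ⊆ K ∧ ∀ p₀ ∈ K, p₀ ∉ V →
    ∃ (k : ℕ) (f : Fin k → S → ℝ) (ε : ℝ), (∀ i, IsBddMeas 𝒜 (f i)) ∧ 0 < ε ∧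
      ∀ p ∈ V, ∃ i, ε ≤ |p.integral (f i) - p₀.integral (f i)|

/-- `V` is weak* closed in the set of all finitely additive probability measures. -/
def IsWeakStarClosed {S : Type*} {𝒜 : SetAlg S} (V : Set (FinAddProb 𝒜)) : Prop :=
  IsWeakStarClosedIn Set.univ V

/-- A system of sets `V_{t₁,…,tₙ}` of finitely additive probability measures on `(Y ^ n, 𝒢 n)`,
indexed by the finite sequences of distinct elements of `T`. -/
abbrev FDSystem (T : Type*) {Y : Type*} (𝒢 : ∀ n : ℕ, SetAlg (Fin n → Y)) :=
  ∀ n : ℕ, (Fin n ↪ T) → Set (FinAddProb (𝒢 n))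

namespace FDSystem

variable {T Y : Type*} {𝒢 : ∀ n : ℕ, SetAlg (Fin n → Y)}

/-- The sets of the system are nonempty and weak* closed. -/
def IsNonemptyClosed (V : FDSystem T 𝒢) : Prop :=
  ∀ (n : ℕ) (t : Fin n ↪ T), 0 < n → (V n t).Nonempty ∧ IsWeakStarClosed (V n t)

/-- Consistency under permutations; `fun y i => y (π i)` is the map
`(y₁, …, yₙ) ↦ (y_{π(1)}, …, y_{π(n)})`. -/
def PermConsistent (V : FDSystem T 𝒢) : Prop :=
  ∀ (n : ℕ) (t : Fin n ↪ T) (π : Equiv.Perm (Fin n)), 0 < n →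
    ∀ v₁ ∈ V n (π.toEmbedding.trans t), ∃ v₂ ∈ V n t,
      ∀ F ∈ (𝒢 n).sets, v₁ F = v₂ ((fun (y : Fin n → Y) (i : Fin n) => y (π i)) ⁻¹' F)

/-- The cylinder `F × Y ^ m` over `F ⊆ Y ^ n`. -/
def cyl {n : ℕ} (m : ℕ) (F : Set (Fin n → Y)) : Set (Fin (n + m) → Y) :=
  {y | (fun i : Fin n => y (Fin.castAdd m i)) ∈ F}

/-- Consistency under marginalization, in both directions. -/
def MargConsistent (V : FDSystem T 𝒢) : Prop :=
  ∀ (n m : ℕ) (t : Fin (n + m) ↪ T), 0 < n →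
    (∀ v₁ ∈ V (n + m) t, ∃ v₂ ∈ V n ((Fin.castAddEmb m).trans t),
      ∀ F ∈ (𝒢 n).sets, v₁ (cyl m F) = v₂ F) ∧
    (∀ v₂ ∈ V n ((Fin.castAddEmb m).trans t), ∃ v₁ ∈ V (n + m) t,
      ∀ F ∈ (𝒢 n).sets, v₁ (cyl m F) = v₂ F)

/-- The maps `[X_{t₁}, …, X_{tₙ}]` are measurable, and the set of the pushforwards under
this map of the members of `P` is `V_{t₁,…,tₙ}`. -/
def IsRepresentedBy (V : FDSystem T 𝒢) {Ω : Type*} {𝒜 : SetAlg Ω} (X : T → Ω → Y)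
    (P : Set (FinAddProb 𝒜)) : Prop :=
  ∀ (n : ℕ) (t : Fin n ↪ T), 0 < n →
    ∃ hX : IsMeasMap 𝒜 (𝒢 n) (fun (ω : Ω) (i : Fin n) => X (t i) ω),
      FinAddProb.map (fun (ω : Ω) (i : Fin n) => X (t i) ω) hX '' P = V n t

end FDSystem

/-! A consistent system of sets `V n t` of finitely additive laws is represented on the coordinate
space `Ω = Y ^ T`, with `X t` the coordinates and `P` the set of *all* measures on `Ω` whose
finite-dimensional laws belong to the system (`FDSystem.admissible`).

The weak* topology on `FinAddProb 𝒜` is the topology of pointwise convergence on sets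
(`IsWeakStarClosed.isClosed`, `IsClosed.isWeakStarClosedIn`): integrals of bounded measurable
functions are uniform limits of finite combinations of values on sets. For this topology
`FinAddProb 𝒜` is a closed subset of a cube, hence compact. Pushforward is continuous, so `P` is
closed. Compactness also shows that a finitely additive probability measure extends to any larger
algebra (`FinAddProb.exists_extension`), because on finitely many sets it can be replaced by a
discrete measure. This is why the σ-algebra of all subsets of `Ω` may be used.

What remains is that each `v ∈ V n t` is the `t`-law of some member of `P`. For a tuple `s` whose
values include those of `t`, let `K s` be the set of measures with `t`-law `v` and `s`-law in `V`.
Consistency under permutations and marginals, with the extension theorem, makes `K s` nonempty and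
decreasing in the range of `s`, so compactness gives a common element
(`FDSystem.isRepresentedBy_admissible`). The converse only needs that reindexing maps between the
powers of `Y` are measurable.

If `Y = ℝ` and all members of the system are σ-additive, take the product σ-algebra on `Ω` and
let `Pσ` be the set of σ-additive members of `P`. It is relatively closed. It has the same laws
as `P` because a finitely additive measure with σ-additive finite-dimensional laws coincides on
cylinders with a σ-additive one: this is Kolmogorov's extension theorem, proved in
`FinAddProb.exists_isSigmaAdditive_eq_on_cylinders` by approximating cylinders from inside by
cylinders with compact bases. -/

open Set Filter Topology MeasureTheory
open scoped ENNReal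

namespace FinAddProb

variable {S : Type*} {𝒜 : SetAlg S}

/-! ### Finite additivity and the integral -/

theorem eq_of_eq_on_sets {p q : FinAddProb 𝒜} (h : ∀ A ∈ 𝒜.sets, p A = q A) : p = q := by
  have : p.toFun = q.toFun := by
    funext A
    by_cases hA : A ∈ 𝒜.sets
    · exact h A hA
    · rw [p.off' A hA, q.off' A hA]
  cases p
  cases q
  simpa using this

theorem toFun_injective : Function.Injective (toFun : FinAddProb 𝒜 → Set S → ℝ) :=
  fun _ _ h => eq_of_eq_on_sets fun A _ => congrFun h A

theorem empty (p : FinAddProb 𝒜) : p ∅ = 0 := by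
  have h := p.union' ∅ 𝒜.isSetAlgebra.empty_mem ∅ 𝒜.isSetAlgebra.empty_mem (disjoint_bot_left)
  simp only [Set.union_self] at h
  linarith

theorem nonneg (p : FinAddProb 𝒜) (A : Set S) : 0 ≤ p A := by
  by_cases hA : A ∈ 𝒜.sets
  · exact p.nonneg' A hA
  · exact (p.off' A hA).ge

theorem mono (p : FinAddProb 𝒜) {A B : Set S} (hA : A ∈ 𝒜.sets) (hB : B ∈ 𝒜.sets)
    (h : A ⊆ B) : p A ≤ p B := by
  have h1 := p.union' A hA (B \ A) (𝒜.isSetAlgebra.sdiff_mem hB hA) disjoint_sdiff_right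
  rw [union_sdiff_cancel h] at h1
  linarith [p.nonneg (B \ A)]

theorem le_one (p : FinAddProb 𝒜) (A : Set S) : p A ≤ 1 := by
  by_cases hA : A ∈ 𝒜.sets
  · exact (p.mono hA 𝒜.isSetAlgebra.univ_mem (subset_univ A)).trans p.univ'.le
  · rw [p.off' A hA]
    exact zero_le_one

theorem union_le (p : FinAddProb 𝒜) {A B : Set S} (hA : A ∈ 𝒜.sets) (hB : B ∈ 𝒜.sets) :
    p (A ∪ B) ≤ p A + p B := by
  have hd := 𝒜.isSetAlgebra.sdiff_mem hB hA
  rw [← union_sdiff_self, p.union' A hA _ hd disjoint_sdiff_right]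
  linarith [p.mono hd hB sdiff_subset]

theorem map_apply {S₁ : Type*} {ℬ : SetAlg S₁} {X : S → S₁} (hX : IsMeasMap 𝒜 ℬ X)
    (p : FinAddProb 𝒜) {F : Set S₁} (hF : F ∈ ℬ.sets) : map X hX p F = p (X ⁻¹' F) :=
  if_pos hF

theorem preimage_finset {β : Type*} {φ : S → β} (hφ : ∀ b, φ ⁻¹' {b} ∈ 𝒜.sets)
    (p : FinAddProb 𝒜) (E : Finset β) :
    φ ⁻¹' E ∈ 𝒜.sets ∧ p (φ ⁻¹' E) = ∑ b ∈ E, p (φ ⁻¹' {b}) := by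
  classical
  induction E using Finset.induction_on with
  | empty => simpa [p.empty] using 𝒜.isSetAlgebra.empty_mem
  | insert a E ha ih =>
    rw [Finset.coe_insert, insert_eq, preimage_union, Finset.sum_insert ha, ← ih.2]
    refine ⟨𝒜.isSetAlgebra.union_mem (hφ a) ih.1, p.union' _ (hφ a) _ ih.1 ?_⟩
    exact Disjoint.preimage φ (by simpa using ha)

theorem sum_fiber_eq_one {β : Type*} {φ : S → β} (hφ : ∀ b, φ ⁻¹' {b} ∈ 𝒜.sets)
    (p : FinAddProb 𝒜) {R : Finset β} (hR : ∀ x, φ x ∈ R) : ∑ b ∈ R, p (φ ⁻¹' {b}) = 1 := by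
  rw [← (p.preimage_finset hφ R).2, ← p.univ']
  congr 1
  exact eq_univ_of_forall hR

/-- The integral of a simple function may be computed on any finite partition of the space into
sets of the algebra on which the function is constant; here the partition is given by the fibers
of `φ`. -/
theorem simpleIntegral_comp {β : Type*} {φ : S → β} (hφ : ∀ b, φ ⁻¹' {b} ∈ 𝒜.sets)
    (p : FinAddProb 𝒜) {R : Finset β} (hR : ∀ x, φ x ∈ R) (h : β → ℝ) :
    p.simpleIntegral (fun x => h (φ x)) = ∑ b ∈ R, h b * p (φ ⁻¹' {b}) := by
  classical
  have hfib : ∀ c, (fun x => h (φ x)) ⁻¹' {c} = φ ⁻¹' (R.filter fun b => h b = c : Finset β) := by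
    intro c
    ext x
    simp [hR x]
  have hs : (Function.support fun c => c * p ((fun x => h (φ x)) ⁻¹' {c})) ⊆ R.image h := by
    intro c hc
    by_contra hcR
    have : (fun x => h (φ x)) ⁻¹' {c} = ∅ := by
      ext x
      simp only [mem_preimage, mem_singleton_iff, mem_empty_iff_false, iff_false]
      rintro rfl
      exact hcR (by simpa using ⟨φ x, hR x, rfl⟩)
    simp [this, p.empty] at hc
  rw [simpleIntegral, finsum_eq_sum_of_support_subset _ hs,
    ← Finset.sum_fiberwise_of_maps_to (t := R.image h) (g := h)
      (fun b hb => Finset.mem_image_of_mem h hb)]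
  refine Finset.sum_congr rfl fun c _ => ?_
  rw [hfib, (p.preimage_finset hφ _).2, Finset.mul_sum]
  refine Finset.sum_congr rfl fun b hb => ?_
  rw [(Finset.mem_filter.1 hb).2]

end FinAddProb

theorem IsSimpleFn.comp_of_fibers {S β : Type*} {𝒜 : SetAlg S} {φ : S → β}
    (hφ : ∀ b, φ ⁻¹' {b} ∈ 𝒜.sets) (hfin : (range φ).Finite) (h : β → ℝ) :
    IsSimpleFn 𝒜 (fun x => h (φ x)) := by
  classical
  refine ⟨(hfin.image h).subset (by rintro _ ⟨x, rfl⟩; exact ⟨φ x, ⟨x, rfl⟩, rfl⟩), fun c => ?_⟩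
  have : (fun x => h (φ x)) ⁻¹' {c} = ⋃ b ∈ hfin.toFinset.filter (fun b => h b = c), φ ⁻¹' {b} := by
    ext x
    simp
  rw [this]
  exact 𝒜.isSetAlgebra.isSetRing.biUnion_mem _ fun b _ => hφ b

theorem isSimpleFn_indicator {S : Type*} {𝒜 : SetAlg S} {A : Set S} (hA : A ∈ 𝒜.sets) :
    IsSimpleFn 𝒜 (A.indicator fun _ => (1 : ℝ)) := by
  classical
  refine ⟨(Set.toFinite {0, 1}).subset ?_, fun c => ?_⟩
  · rintro _ ⟨x, rfl⟩
    by_cases hx : x ∈ A <;> simp [hx]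
  · rw [Set.indicator_const_preimage_eq_union]
    refine 𝒜.isSetAlgebra.union_mem ?_ ?_ <;> split_ifs
    · exact hA
    · exact 𝒜.isSetAlgebra.empty_mem
    · exact 𝒜.isSetAlgebra.compl_mem hA
    · exact 𝒜.isSetAlgebra.empty_mem

theorem IsSimpleFn.isBddMeas {S : Type*} {𝒜 : SetAlg S} {s : S → ℝ} (hs : IsSimpleFn 𝒜 s) :
    IsBddMeas 𝒜 s :=
  fun ε hε => ⟨s, hs, fun x => by simpa using hε.le⟩

namespace FinAddProb

variable {S : Type*} {𝒜 : SetAlg S}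

theorem simpleIntegral_eq_sum (p : FinAddProb 𝒜) {s : S → ℝ} (hs : IsSimpleFn 𝒜 s) :
    p.simpleIntegral s = ∑ c ∈ hs.1.toFinset, c * p (s ⁻¹' {c}) :=
  p.simpleIntegral_comp hs.2 (φ := s) (by simp) id

theorem simpleIntegral_le_add (p : FinAddProb 𝒜) {s s' : S → ℝ} (hs : IsSimpleFn 𝒜 s)
    (hs' : IsSimpleFn 𝒜 s') {ε : ℝ} (h : ∀ x, s x ≤ s' x + ε) :
    p.simpleIntegral s ≤ p.simpleIntegral s' + ε := by
  have hφ : ∀ b : ℝ × ℝ, (fun x => (s x, s' x)) ⁻¹' {b} ∈ 𝒜.sets := by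
    rintro ⟨b, b'⟩
    have : (fun x => (s x, s' x)) ⁻¹' {(b, b')} = s ⁻¹' {b} ∩ s' ⁻¹' {b'} := by
      ext x
      simp
    rw [this]
    exact 𝒜.isSetAlgebra.inter_mem (hs.2 b) (hs'.2 b')
  have hR : ∀ x, (s x, s' x) ∈ hs.1.toFinset ×ˢ hs'.1.toFinset := by simp
  have e1 := p.simpleIntegral_comp hφ hR Prod.fst
  have e2 := p.simpleIntegral_comp hφ hR Prod.snd
  have e3 := p.sum_fiber_eq_one hφ hR
  simp only at e1 e2
  rw [e1, e2, ← mul_one ε, ← e3, Finset.mul_sum, ← Finset.sum_add_distrib]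
  refine Finset.sum_le_sum fun b _ => ?_
  rw [← add_mul]
  -- a pair of values that is not attained has weight zero
  rcases ((fun x => (s x, s' x)) ⁻¹' {b}).eq_empty_or_nonempty with hb | ⟨x, hx⟩
  · simp [hb, p.empty]
  · refine mul_le_mul_of_nonneg_right ?_ (p.nonneg _)
    obtain rfl : (s x, s' x) = b := hx
    exact h x

theorem abs_integral_sub_simpleIntegral_le (p : FinAddProb 𝒜) {f s : S → ℝ}
    (hs : IsSimpleFn 𝒜 s) {ε : ℝ} (h : ∀ x, |f x - s x| ≤ ε) :
    |p.integral f - p.simpleIntegral s| ≤ ε := by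
  have hs' : IsSimpleFn 𝒜 (fun x => s x - ε) := .comp_of_fibers hs.2 hs.1 fun c => c - ε
  have hub : ∀ r ∈ {r : ℝ | ∃ u : S → ℝ, IsSimpleFn 𝒜 u ∧ (∀ x, u x ≤ f x) ∧
      r = p.simpleIntegral u}, r ≤ p.simpleIntegral s + ε := by
    rintro _ ⟨u, hu, huf, rfl⟩
    exact p.simpleIntegral_le_add hu hs fun x => by linarith [huf x, (abs_le.1 (h x)).2]
  have hmem : p.simpleIntegral (fun x => s x - ε) ∈ {r : ℝ | ∃ u : S → ℝ, IsSimpleFn 𝒜 u ∧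
      (∀ x, u x ≤ f x) ∧ r = p.simpleIntegral u} :=
    ⟨_, hs', fun x => by linarith [(abs_le.1 (h x)).1], rfl⟩
  have h1 : p.integral f ≤ p.simpleIntegral s + ε := csSup_le ⟨_, hmem⟩ hub
  have h2 : p.simpleIntegral (fun x => s x - ε) ≤ p.integral f := le_csSup ⟨_, hub⟩ hmem
  have h3 := p.simpleIntegral_le_add hs hs' (ε := ε) fun x => by simp
  rw [abs_le]
  constructor <;> linarith

theorem integral_indicator (p : FinAddProb 𝒜) {A : Set S} (hA : A ∈ 𝒜.sets) :
    p.integral (A.indicator fun _ => (1 : ℝ)) = p A := by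
  have hs := isSimpleFn_indicator hA
  have h1 := p.abs_integral_sub_simpleIntegral_le hs (f := A.indicator fun _ => 1) (ε := 0)
    (by simp)
  have h2 := p.simpleIntegral_comp hs.2 (R := {0, 1})
    (by intro x; by_cases hx : x ∈ A <;> simp [hx]) id
  have h3 : (A.indicator fun _ => (1 : ℝ)) ⁻¹' {1} = A := by
    ext x
    by_cases hx : x ∈ A <;> simp [hx]
  rw [abs_nonpos_iff, sub_eq_zero] at h1
  rw [h1]
  simpa [h3] using h2

/-! ### The weak* topology is the compact topology of setwise convergence -/

/-- The topology of setwise convergence. -/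
instance : TopologicalSpace (FinAddProb 𝒜) := TopologicalSpace.induced toFun inferInstance

theorem isEmbedding_toFun : IsEmbedding (toFun : FinAddProb 𝒜 → Set S → ℝ) :=
  ⟨⟨rfl⟩, toFun_injective⟩

instance : T2Space (FinAddProb 𝒜) := isEmbedding_toFun.t2Space

theorem continuous_apply (A : Set S) : Continuous fun p : FinAddProb 𝒜 => p A :=
  (_root_.continuous_apply A).comp isEmbedding_toFun.continuous

theorem continuous_map {S₁ : Type*} {ℬ : SetAlg S₁} {X : S → S₁} (hX : IsMeasMap 𝒜 ℬ X) :
    Continuous (map X hX : FinAddProb 𝒜 → FinAddProb ℬ) := by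
  refine isEmbedding_toFun.continuous_iff.2 (continuous_pi fun F => ?_)
  by_cases hF : F ∈ ℬ.sets
  · simpa [Function.comp_def, map_apply hX _ hF] using continuous_apply (X ⁻¹' F)
  · simpa [Function.comp_def, off' _ _ hF] using continuous_const

theorem isClosed_range_toFun : IsClosed (range (toFun : FinAddProb 𝒜 → Set S → ℝ)) := by
  have : range (toFun : FinAddProb 𝒜 → Set S → ℝ) =
      (⋂ A ∈ 𝒜.sets, {f | 0 ≤ f A}) ∩ {f | f univ = 1} ∩
      (⋂ A ∈ 𝒜.sets, ⋂ B ∈ 𝒜.sets, ⋂ _ : Disjoint A B, {f | f (A ∪ B) = f A + f B}) ∩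
      ⋂ A, ⋂ _ : A ∉ 𝒜.sets, {f | f A = 0} := by
    ext f
    simp only [mem_range, mem_inter_iff, mem_iInter, mem_ofPred_eq]
    constructor
    · rintro ⟨p, rfl⟩
      exact ⟨⟨⟨p.nonneg', p.univ'⟩, p.union'⟩, p.off'⟩
    · rintro ⟨⟨⟨h1, h2⟩, h3⟩, h4⟩
      exact ⟨⟨f, h1, h2, h3, h4⟩, rfl⟩
  rw [this]
  refine ((IsClosed.inter ?_ ?_).inter ?_).inter ?_
  · exact isClosed_biInter fun A _ => isClosed_le continuous_const (_root_.continuous_apply A)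
  · exact isClosed_eq (_root_.continuous_apply _) continuous_const
  · exact isClosed_biInter fun A _ => isClosed_biInter fun B _ => isClosed_iInter fun _ =>
      isClosed_eq (_root_.continuous_apply _)
        ((_root_.continuous_apply A).add (_root_.continuous_apply B))
  · exact isClosed_iInter fun A => isClosed_iInter fun _ =>
      isClosed_eq (_root_.continuous_apply A) continuous_const

instance : CompactSpace (FinAddProb 𝒜) := by
  have hK : IsCompact (Set.univ.pi fun _ : Set S => Icc (0 : ℝ) 1) :=
    isCompact_univ_pi fun _ => isCompact_Icc
  have hr : IsCompact (range (toFun : FinAddProb 𝒜 → Set S → ℝ)) := by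
    refine hK.of_isClosed_subset isClosed_range_toFun ?_
    rintro _ ⟨p, rfl⟩ A -
    exact ⟨p.nonneg A, p.le_one A⟩
  exact ⟨by rwa [isEmbedding_toFun.isCompact_iff, image_univ]⟩

theorem continuous_integral {f : S → ℝ} (hf : IsBddMeas 𝒜 f) :
    Continuous fun p : FinAddProb 𝒜 => p.integral f := by
  refine continuous_of_uniform_approx_of_continuous fun u hu => ?_
  obtain ⟨ε, hε, hεu⟩ := Metric.mem_uniformity_dist.1 hu
  obtain ⟨s, hs, hfs⟩ := hf (ε / 2) (half_pos hε)
  refine ⟨fun p => p.simpleIntegral s, ?_, fun p => hεu ?_⟩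
  · simp only [simpleIntegral_eq_sum _ hs]
    exact continuous_finsetSum _ fun c _ => (continuous_apply _).const_mul c
  · rw [Real.dist_eq]
    exact (p.abs_integral_sub_simpleIntegral_le hs hfs).trans_lt (half_lt_self hε)

end FinAddProb

theorem IsWeakStarClosed.isClosed {S : Type*} {𝒜 : SetAlg S} {V : Set (FinAddProb 𝒜)}
    (hV : IsWeakStarClosed V) : IsClosed V := by
  rw [← isOpen_compl_iff, isOpen_iff_mem_nhds]
  intro p₀ hp₀
  obtain ⟨k, f, ε, hf, hε, h⟩ := hV.2 p₀ (mem_univ _) hp₀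
  have : ∀ᶠ p in 𝓝 p₀, ∀ i, |p.integral (f i) - p₀.integral (f i)| < ε := by
    refine eventually_all.2 fun i => ?_
    simpa [Real.dist_eq] using
      (FinAddProb.continuous_integral (hf i)).continuousAt.eventually (Metric.ball_mem_nhds _ hε)
  filter_upwards [this] with p hp hpV
  obtain ⟨i, hi⟩ := h p hpV
  exact (hp i).not_ge hi

/-- Setwise closed sets are weak* closed: it suffices to test against indicators. -/
theorem IsClosed.isWeakStarClosedIn {S : Type*} {𝒜 : SetAlg S} {C : Set (FinAddProb 𝒜)}
    (hC : IsClosed C) (K : Set (FinAddProb 𝒜)) : IsWeakStarClosedIn K (C ∩ K) := by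
  classical
  refine ⟨inter_subset_right, fun p₀ hp₀ hp₀C => ?_⟩
  have hmem : Cᶜ ∈ 𝓝 p₀ := hC.isOpen_compl.mem_nhds fun h => hp₀C ⟨h, hp₀⟩
  rw [nhds_induced, mem_comap] at hmem
  obtain ⟨W, hW, hWC⟩ := hmem
  obtain ⟨I, u, hu, hIW⟩ : ∃ (I : Finset (Set S)) (u : Set S → Set ℝ),
      (∀ A, u A ∈ 𝓝 (p₀ A)) ∧ (I : Set (Set S)).pi u ⊆ W := by
    rw [nhds_pi, Filter.mem_pi] at hW
    obtain ⟨I, hI, u, hu, h⟩ := hW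
    exact ⟨hI.toFinset, u, hu, by simpa using h⟩
  obtain ⟨ε, hεu, hε⟩ : ∃ ε : ℝ, (∀ A ∈ I, Metric.ball (p₀ A) ε ⊆ u A) ∧ 0 < ε := by
    have : ∀ᶠ ε : ℝ in 𝓝[>] 0, ∀ A ∈ I, Metric.ball (p₀ A) ε ⊆ u A := by
      refine (Filter.eventually_all_finset I).2 fun A _ => ?_
      obtain ⟨δ, hδ, hδu⟩ := Metric.mem_nhds_iff.1 (hu A)
      filter_upwards [Ioo_mem_nhdsGT hδ] with ε hε
      exact (Metric.ball_subset_ball hε.2.le).trans hδu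
    exact (this.and self_mem_nhdsWithin).exists
  let J := I.filter (· ∈ 𝒜.sets)
  have hJ : ∀ j : J, (j : Set S) ∈ 𝒜.sets := fun j => (Finset.mem_filter.1 j.2).2
  refine ⟨J.card, fun i => (J.equivFin.symm i : Set S).indicator fun _ => 1, ε,
    fun i => (isSimpleFn_indicator (hJ _)).isBddMeas, hε, fun p hp => ?_⟩
  by_contra! hlt
  refine hWC (hIW fun A hA => hεu A hA ?_ : p.toFun ∈ W) hp.1
  rw [Metric.mem_ball, Real.dist_eq]
  by_cases hA' : A ∈ 𝒜.sets
  · have := hlt (J.equivFin ⟨A, Finset.mem_filter.2 ⟨hA, hA'⟩⟩)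
    simpa [FinAddProb.integral_indicator _ hA'] using this
  · simpa [FinAddProb.off' _ _ hA'] using hε

theorem IsClosed.isWeakStarClosed {S : Type*} {𝒜 : SetAlg S} {C : Set (FinAddProb 𝒜)}
    (hC : IsClosed C) : IsWeakStarClosed C := by
  simpa [IsWeakStarClosed] using hC.isWeakStarClosedIn univ

/-! ### Extension of finitely additive probability measures -/

namespace FinAddProb

variable {S : Type*} {𝒜 : SetAlg S}

open Classical in
/-- The measure on `ℬ` with mass `w i` at the point `x i`. The points may coincide, and their
singletons need not belong to `ℬ`. -/
noncomputable def discrete {ι : Type*} [Fintype ι] (ℬ : SetAlg S) (x : ι → S) (w : ι → ℝ)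
    (hw : ∀ i, 0 ≤ w i) (hw1 : ∑ i, w i = 1) : FinAddProb ℬ where
  toFun A := if A ∈ ℬ.sets then ∑ i, A.indicator (fun _ => w i) (x i) else 0
  nonneg' A hA := by
    rw [if_pos hA]
    exact Finset.sum_nonneg fun i _ => indicator_nonneg (fun _ _ => hw i) _
  univ' := by
    rw [if_pos ℬ.isSetAlgebra.univ_mem]
    simpa using hw1
  union' A hA B hB hAB := by
    rw [if_pos hA, if_pos hB, if_pos (ℬ.isSetAlgebra.union_mem hA hB), ← Finset.sum_add_distrib]
    exact Finset.sum_congr rfl fun i _ => by rw [indicator_union_of_disjoint hAB]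
  off' A hA := if_neg hA

theorem nonempty_space (p : FinAddProb 𝒜) : Nonempty S := by
  by_contra h
  rw [not_nonempty_iff] at h
  have h1 := p.univ'
  rw [univ_eq_empty_iff.2 h, p.empty] at h1
  exact zero_ne_one h1

/-- On finitely many sets of the algebra, `p` agrees with a discrete measure: put the mass of each
atom of the finite algebra that they generate at one point of the atom. -/
theorem exists_eq_on_finset (p : FinAddProb 𝒜) {ℬ : SetAlg S} (h𝒜ℬ : 𝒜.sets ⊆ ℬ.sets)
    (J : Finset (Set S)) (hJ : ∀ A ∈ J, A ∈ 𝒜.sets) :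
    ∃ q : FinAddProb ℬ, ∀ A ∈ J, q A = p A := by
  classical
  have := p.nonempty_space
  let φ : S → (J → Prop) := fun x A => x ∈ (A : Set S)
  have hφ : ∀ σ, φ ⁻¹' {σ} ∈ 𝒜.sets := by
    intro σ
    have : φ ⁻¹' {σ} = ⋂ A ∈ (Finset.univ : Finset J), if σ A then (A : Set S) else (A : Set S)ᶜ := by
      ext x
      simp only [mem_preimage, mem_singleton_iff, funext_iff, mem_iInter, Finset.mem_univ,
        forall_true_left, φ]
      refine forall_congr' fun A => ?_
      by_cases h : σ A <;> simp [h]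
    rw [this]
    refine 𝒜.isSetAlgebra.biInter_mem _ fun A _ => ?_
    split_ifs
    · exact hJ A A.2
    · exact 𝒜.isSetAlgebra.compl_mem (hJ A A.2)
  refine ⟨discrete ℬ (Function.invFun φ) (fun σ => p (φ ⁻¹' {σ})) (fun σ => p.nonneg _)
    (p.sum_fiber_eq_one hφ fun x => Finset.mem_univ _), fun A hA => ?_⟩
  have hA' : A = φ ⁻¹' (Finset.univ.filter fun σ : J → Prop => σ ⟨A, hA⟩ : Finset (J → Prop)) := by
    ext x
    simp [φ]
  have hq : discrete ℬ (Function.invFun φ) (fun σ => p (φ ⁻¹' {σ})) (fun σ => p.nonneg _)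
      (p.sum_fiber_eq_one hφ fun x => Finset.mem_univ _) A =
      ∑ σ, A.indicator (fun _ => p (φ ⁻¹' {σ})) (Function.invFun φ σ) :=
    if_pos (h𝒜ℬ (hJ A hA))
  rw [hq]
  conv_rhs => rw [hA', (p.preimage_finset hφ _).2, Finset.sum_filter]
  refine Finset.sum_congr rfl fun σ _ => ?_
  by_cases hσ : ∃ x, φ x = σ
  · have h1 : φ (Function.invFun φ σ) = σ := Function.invFun_eq hσ
    have h2 : Function.invFun φ σ ∈ A ↔ σ ⟨A, hA⟩ := by
      conv_rhs => rw [← h1]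
    by_cases h3 : σ ⟨A, hA⟩
    · rw [if_pos h3, indicator_of_mem (h2.2 h3)]
    · rw [if_neg h3, indicator_of_notMem (mt h2.1 h3)]
  · have : φ ⁻¹' {σ} = ∅ := by
      ext x
      simpa using fun h => hσ ⟨x, h⟩
    simp [this, p.empty]

/-- By compactness, a finitely additive probability measure extends to any larger algebra. -/
theorem exists_extension (p : FinAddProb 𝒜) {ℬ : SetAlg S} (h𝒜ℬ : 𝒜.sets ⊆ ℬ.sets) :
    ∃ q : FinAddProb ℬ, ∀ A ∈ 𝒜.sets, q A = p A := by
  have h := isCompact_univ.inter_iInter_nonempty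
    (fun A : 𝒜.sets => {q : FinAddProb ℬ | q A = p A})
    (fun A => isClosed_eq (continuous_apply _) continuous_const) fun J => by
      classical
      obtain ⟨q, hq⟩ := p.exists_eq_on_finset h𝒜ℬ (J.image Subtype.val) (by simp +contextual)
      refine ⟨q, mem_univ _, mem_iInter₂.2 fun A hA => hq A (Finset.mem_image_of_mem _ hA)⟩
  obtain ⟨q, -, hq⟩ := h
  exact ⟨q, fun A hA => mem_iInter.1 hq ⟨A, hA⟩⟩

/-- Every finitely additive probability measure is the pushforward of another one under a given
surjection: extend it to all subsets and transport it along a section. -/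
theorem exists_map_eq {S₁ : Type*} {ℬ : SetAlg S₁} {X : S → S₁} (hX : IsMeasMap 𝒜 ℬ X)
    (hsurj : Function.Surjective X) (q : FinAddProb ℬ) : ∃ p : FinAddProb 𝒜, map X hX p = q := by
  obtain ⟨q', hq'⟩ := q.exists_extension (ℬ := .ofMeasurableSpace ⊤)
    fun A _ => MeasurableSpace.measurableSet_top
  have hg : IsMeasMap (.ofMeasurableSpace ⊤) 𝒜 (Function.surjInv hsurj) :=
    fun A _ => MeasurableSpace.measurableSet_top
  refine ⟨map _ hg q', eq_of_eq_on_sets fun F hF => ?_⟩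
  rw [map_apply hX _ hF, map_apply hg _ (hX F hF), ← preimage_comp,
    (Function.rightInverse_surjInv hsurj).comp_eq_id, preimage_id, hq' F hF]

end FinAddProb

/-! ### Changes of coordinates -/

/-- The maps `y ↦ y ∘ g` between powers of `Y` that select, permute or repeat coordinates are
measurable. -/
def HasMeasurableReindexing {Y : Type*} (𝒢 : ∀ n : ℕ, SetAlg (Fin n → Y)) : Prop :=
  ∀ (n m : ℕ) (g : Fin n → Fin m), IsMeasMap (𝒢 m) (𝒢 n) fun y i => y (g i)

theorem SetAlg.hasMeasurableReindexing_pow {Y : Type*} (𝓕 : SetAlg Y) :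
    HasMeasurableReindexing fun n => 𝓕.pow n := by
  classical
  intro n m g F hF
  have hm := (𝓕.pow m).isSetAlgebra
  change MeasureTheory.generateSetAlgebra _ F at hF
  induction hF with
  | base F hF =>
    obtain ⟨F, hF, rfl⟩ := hF
    refine MeasureTheory.generateSetAlgebra.base _
      ⟨fun j => ⋂ i ∈ Finset.univ.filter fun i => g i = j, F i,
        fun j => 𝓕.isSetAlgebra.biInter_mem _ fun i _ => hF i, ?_⟩
    ext y
    simpa using ⟨fun h _ i hi => hi ▸ h i, fun h i => h _ i rfl⟩
  | empty => exact hm.empty_mem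
  | compl F _ ih => exact hm.compl_mem ih
  | union F G _ _ ih ih' => exact hm.union_mem ih ih'

theorem SetAlg.hasMeasurableReindexing_sigmaPow {Y : Type*} (m : MeasurableSpace Y) :
    HasMeasurableReindexing fun n => SetAlg.sigmaPow m n := by
  intro n k g F hF
  have : Measurable fun (y : Fin k → Y) (i : Fin n) => y (g i) := by fun_prop
  exact this hF

theorem HasMeasurableReindexing.cyl_mem {Y : Type*} {𝒢 : ∀ n : ℕ, SetAlg (Fin n → Y)}
    (h𝒢 : HasMeasurableReindexing 𝒢) {n : ℕ} (m : ℕ) {F : Set (Fin n → Y)}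
    (hF : F ∈ (𝒢 n).sets) : FDSystem.cyl m F ∈ (𝒢 (n + m)).sets :=
  h𝒢 n (n + m) (Fin.castAdd m) F hF

/-- If the values of `s` are among those of `s'`, then `s` is an initial segment of a permutation
of `s'`. -/
theorem exists_perm_of_range_subset {T : Type*} {n k : ℕ} {s : Fin n ↪ T} {s' : Fin k ↪ T}
    (h : range s ⊆ range s') : ∃ (m : ℕ) (e : k = n + m) (π : Equiv.Perm (Fin (n + m))),
      ∀ i, s' (Fin.cast e.symm (π (Fin.castAdd m i))) = s i := by
  choose g hg using fun i => h (mem_range_self i)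
  have hginj : Function.Injective g := fun i j hij => s.injective (by rw [← hg i, ← hg j, hij])
  have hnk : n ≤ k := by simpa using Fintype.card_le_of_injective g hginj
  obtain ⟨m, rfl⟩ := Nat.exists_eq_add_of_le hnk
  obtain ⟨π, hπ⟩ := Equiv.Perm.exists_extending_pair (Fin.castAdd m) g
    (Fin.castAdd_injective n m) hginj
  exact ⟨m, rfl, π, fun i => (congrArg s' (hπ i)).trans (hg i)⟩

theorem exists_tuple_range_eq {T : Type*} {A : Set T} (hA : A.Finite) :
    ∃ (n : ℕ) (s : Fin n ↪ T), range s = A := by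
  have := hA.to_subtype
  obtain ⟨n, ⟨e⟩⟩ := Finite.exists_equiv_fin A
  refine ⟨n, e.symm.toEmbedding.trans (Function.Embedding.subtype (· ∈ A)), ?_⟩
  ext x
  exact ⟨by rintro ⟨i, rfl⟩; exact (e.symm i).2, fun hx => ⟨e ⟨x, hx⟩, by simp⟩⟩

namespace FDSystem

variable {T Y : Type*} {𝒢 : ∀ n : ℕ, SetAlg (Fin n → Y)} {V : FDSystem T 𝒢}
  {Ω : Type*} {𝒜 : SetAlg Ω} {X : T → Ω → Y}

open FinAddProb

theorem IsRepresentedBy.permConsistent {P : Set (FinAddProb 𝒜)} (hP : V.IsRepresentedBy X P)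
    (h𝒢 : HasMeasurableReindexing 𝒢) : V.PermConsistent := by
  intro n t π hn v₁ hv₁
  obtain ⟨hX, h⟩ := hP n t hn
  obtain ⟨hX', h'⟩ := hP n (π.toEmbedding.trans t) hn
  rw [← h'] at hv₁
  obtain ⟨p, hp, rfl⟩ := hv₁
  refine ⟨_, h ▸ mem_image_of_mem _ hp, fun F hF => ?_⟩
  rw [map_apply _ _ hF, map_apply _ _ (h𝒢 n n π F hF)]
  rfl

theorem IsRepresentedBy.margConsistent {P : Set (FinAddProb 𝒜)} (hP : V.IsRepresentedBy X P)
    (h𝒢 : HasMeasurableReindexing 𝒢) : V.MargConsistent := by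
  intro n m t hn
  obtain ⟨hX, h⟩ := hP (n + m) t (by omega)
  obtain ⟨hX', h'⟩ := hP n ((Fin.castAddEmb m).trans t) hn
  have key : ∀ p : FinAddProb 𝒜, ∀ F ∈ (𝒢 n).sets, map _ hX p (cyl m F) = map _ hX' p F := by
    intro p F hF
    rw [map_apply _ _ hF, map_apply _ _ (h𝒢.cyl_mem m hF)]
    rfl
  rw [← h, ← h']
  constructor
  · rintro _ ⟨p, hp, rfl⟩
    exact ⟨_, mem_image_of_mem _ hp, key p⟩
  · rintro _ ⟨p, hp, rfl⟩
    exact ⟨_, mem_image_of_mem _ hp, key p⟩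

/-! ### Construction of the representation -/

/-- The joint law of a tuple of coordinates determines that of any tuple with fewer values, and
consistency turns this into a statement about membership in `V`. -/
theorem map_mem_of_range_subset (h𝒢 : HasMeasurableReindexing 𝒢) (hperm : V.PermConsistent)
    (hmarg : V.MargConsistent)
    (hX : ∀ (n : ℕ) (t : Fin n ↪ T), IsMeasMap 𝒜 (𝒢 n) fun ω i => X (t i) ω)
    {n k : ℕ} (hn : 0 < n) {s : Fin n ↪ T} {s' : Fin k ↪ T} (hs : range s ⊆ range s')
    {p : FinAddProb 𝒜} (hp : map _ (hX k s') p ∈ V k s') : map _ (hX n s) p ∈ V n s := by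
  obtain ⟨m, rfl, π, hπ⟩ := exists_perm_of_range_subset hs
  set r : Fin (n + m) ↪ T := π.toEmbedding.trans s' with hr
  have hrs' : (π⁻¹).toEmbedding.trans r = s' := by
    ext i
    simp [hr]
  have hrs : (Fin.castAddEmb m).trans r = s := by
    ext i
    simpa [hr] using hπ i
  obtain ⟨v, hv, hvp⟩ := hperm (n + m) r π⁻¹ (by omega) (map _ (hX _ s') p) (by rwa [hrs'])
  have hv' : v = map _ (hX _ r) p := by
    refine eq_of_eq_on_sets fun F hF => ?_
    have h := hvp _ (h𝒢 _ _ π F hF)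
    rw [map_apply _ _ (h𝒢 _ _ π F hF)] at h
    rw [map_apply _ _ hF]
    refine Eq.trans (congrArg v ?_) (h.symm.trans (congrArg p ?_))
    · ext y
      simp
    · ext ω
      simp [hr]
  subst hv'
  obtain ⟨u, hu, hup⟩ := (hmarg n m r hn).1 _ hv
  rw [hrs] at hu
  convert hu using 1
  refine eq_of_eq_on_sets fun F hF => ?_
  rw [← hup F hF, map_apply _ _ hF,
    map_apply _ _ (h𝒢.cyl_mem m hF)]
  refine congrArg p ?_
  ext ω
  simp [cyl, ← hrs]

/-- Every member of `V n t` is the law of the `t`-coordinates under some measure whose law on a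
given larger tuple is admissible. -/
theorem exists_map_eq_and_map_mem (h𝒢 : HasMeasurableReindexing 𝒢) (hperm : V.PermConsistent)
    (hmarg : V.MargConsistent)
    (hX : ∀ (n : ℕ) (t : Fin n ↪ T), IsMeasMap 𝒜 (𝒢 n) fun ω i => X (t i) ω)
    (hsurj : ∀ (n : ℕ) (t : Fin n ↪ T), Function.Surjective fun ω i => X (t i) ω)
    {n k : ℕ} (hn : 0 < n) {t : Fin n ↪ T} {s : Fin k ↪ T} (hs : range t ⊆ range s)
    {v : FinAddProb (𝒢 n)} (hv : v ∈ V n t) :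
    ∃ p : FinAddProb 𝒜, map _ (hX n t) p = v ∧ map _ (hX k s) p ∈ V k s := by
  obtain ⟨m, rfl, π, hπ⟩ := exists_perm_of_range_subset hs
  set r : Fin (n + m) ↪ T := π.toEmbedding.trans s with hr
  have hrt : (Fin.castAddEmb m).trans r = t := by
    ext i
    simpa [hr] using hπ i
  obtain ⟨u, hu, huv⟩ := (hmarg n m r hn).2 v (by rwa [hrt])
  obtain ⟨p, rfl⟩ := exists_map_eq (hX _ r) (hsurj _ r) u
  refine ⟨p, eq_of_eq_on_sets fun F hF => ?_, ?_⟩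
  · rw [← huv F hF, map_apply _ _ hF,
      map_apply _ _ (h𝒢.cyl_mem m hF)]
    refine congrArg p ?_
    ext ω
    simp [cyl, ← hrt]
  · refine map_mem_of_range_subset h𝒢 hperm hmarg hX (by omega) ?_ hu
    rw [hr]
    rintro _ ⟨i, rfl⟩
    exact ⟨π.symm i, by simp⟩

/-- The measures on `Ω` all of whose finite-dimensional laws belong to the system. -/
def admissible (V : FDSystem T 𝒢)
    (hX : ∀ (n : ℕ) (t : Fin n ↪ T), IsMeasMap 𝒜 (𝒢 n) fun ω i => X (t i) ω) :
    Set (FinAddProb 𝒜) :=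
  {p | ∀ (n : ℕ) (t : Fin n ↪ T), 0 < n → map _ (hX n t) p ∈ V n t}

theorem isClosed_admissible (hV : V.IsNonemptyClosed)
    (hX : ∀ (n : ℕ) (t : Fin n ↪ T), IsMeasMap 𝒜 (𝒢 n) fun ω i => X (t i) ω) :
    IsClosed (V.admissible hX) := by
  simp only [admissible, ofPred_forall]
  exact isClosed_iInter fun n => isClosed_iInter fun t => isClosed_iInter fun hn =>
    (hV n t hn).2.isClosed.preimage (continuous_map _)

/-- For a fixed `v ∈ V n t`, the measures with `t`-law `v` and admissible `s`-law form nonempty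
compact sets that decrease as the tuple `s ⊇ t` grows; an element of their intersection is
admissible and has `t`-law `v`. -/
theorem isRepresentedBy_admissible (h𝒢 : HasMeasurableReindexing 𝒢) (hV : V.IsNonemptyClosed)
    (hperm : V.PermConsistent) (hmarg : V.MargConsistent)
    (hX : ∀ (n : ℕ) (t : Fin n ↪ T), IsMeasMap 𝒜 (𝒢 n) fun ω i => X (t i) ω)
    (hsurj : ∀ (n : ℕ) (t : Fin n ↪ T), Function.Surjective fun ω i => X (t i) ω) :
    V.IsRepresentedBy X (V.admissible hX) := by
  intro n t hn
  refine ⟨hX n t, Subset.antisymm ?_ fun v hv => ?_⟩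
  · rintro _ ⟨p, hp, rfl⟩
    exact hp n t hn
  let ι := {s : Σ k, Fin k ↪ T // range t ⊆ range s.2}
  let K : ι → Set (FinAddProb 𝒜) := fun s =>
    {p | map _ (hX n t) p = v} ∩ {p | map _ (hX _ s.1.2) p ∈ V _ s.1.2}
  have hpos : ∀ s : ι, 0 < s.1.1 := fun s => by
    obtain ⟨j, -⟩ := s.2 (mem_range_self ⟨0, hn⟩)
    exact j.pos
  have hmono : ∀ s s' : ι, range s.1.2 ⊆ range s'.1.2 → K s' ⊆ K s := fun s s' h p hp =>
    ⟨hp.1, map_mem_of_range_subset h𝒢 hperm hmarg hX (hpos s) h hp.2⟩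
  have hclosed : ∀ s, IsClosed (K s) := fun s =>
    (isClosed_singleton.preimage (continuous_map (hX n t))).inter
      ((hV _ _ (hpos s)).2.isClosed.preimage (continuous_map _))
  have hsup : ∀ A : Set T, A.Finite → range t ⊆ A → ∃ s : ι, range s.1.2 = A := by
    intro A hA htA
    obtain ⟨k, s, rfl⟩ := exists_tuple_range_eq hA
    exact ⟨⟨⟨k, s⟩, htA⟩, rfl⟩
  have : Nonempty ι := ⟨⟨⟨n, t⟩, Subset.rfl⟩⟩
  obtain ⟨p, hp⟩ := IsCompact.nonempty_iInter_of_directed_nonempty_isCompact_isClosed K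
    (fun s s' => by
      obtain ⟨s'', hs''⟩ := hsup (range s.1.2 ∪ range s'.1.2)
        ((finite_range _).union (finite_range _)) (s.2.trans subset_union_left)
      exact ⟨s'', hmono _ _ (hs'' ▸ subset_union_left), hmono _ _ (hs'' ▸ subset_union_right)⟩)
    (fun s => exists_map_eq_and_map_mem h𝒢 hperm hmarg hX hsurj hn s.2 hv)
    (fun s => (hclosed s).isCompact) hclosed
  rw [mem_iInter] at hp
  refine ⟨p, fun k s hk => ?_, (hp ⟨⟨n, t⟩, Subset.rfl⟩).1⟩
  obtain ⟨s', hs'⟩ := hsup (range s ∪ range t) ((finite_range _).union (finite_range _))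
    subset_union_right
  exact map_mem_of_range_subset h𝒢 hperm hmarg hX hk (hs' ▸ subset_union_left) (hp s').2

end FDSystem

/-! ### The coordinate space -/

theorem surjective_coordinates {T Y : Type*} [Nonempty Y] (n : ℕ) (t : Fin n ↪ T) :
    Function.Surjective fun (ω : ULift T → Y) i => ω ⟨t i⟩ := by
  classical
  intro y
  refine ⟨fun s => Function.extend t y (fun _ => Classical.ofNonempty) s.down, ?_⟩
  funext i
  exact t.injective.extend_apply _ _ i

namespace FDSystem

theorem consistent_iff_exists_isRepresentedBy {T : Type u} {Y : Type v} [Nonempty Y]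
    {𝒢 : ∀ n : ℕ, SetAlg (Fin n → Y)} (h𝒢 : HasMeasurableReindexing 𝒢) (V : FDSystem T 𝒢)
    (hV : V.IsNonemptyClosed) :
    (V.PermConsistent ∧ V.MargConsistent) ↔
      ∃ (Ω : Type (max u v w)) (𝒜 : MeasurableSpace Ω)
        (P : Set (FinAddProb (SetAlg.ofMeasurableSpace 𝒜))) (X : T → Ω → Y),
        IsWeakStarClosed P ∧ V.IsRepresentedBy X P := by
  constructor
  · rintro ⟨hperm, hmarg⟩
    -- on the σ-algebra of all subsets, every map is measurable
    have hX : ∀ (n : ℕ) (t : Fin n ↪ T), IsMeasMap (SetAlg.ofMeasurableSpace ⊤) (𝒢 n)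
        fun (ω : ULift.{w} T → Y) i => ω ⟨t i⟩ := fun n t F _ => MeasurableSpace.measurableSet_top
    exact ⟨ULift.{w} T → Y, ⊤, V.admissible hX, fun t ω => ω ⟨t⟩,
      (isClosed_admissible hV hX).isWeakStarClosed,
      isRepresentedBy_admissible h𝒢 hV hperm hmarg hX surjective_coordinates⟩
  · rintro ⟨Ω, 𝒜, P, X, -, hP⟩
    exact ⟨hP.permConsistent h𝒢, hP.margConsistent h𝒢⟩

end FDSystem

/-! ### Kolmogorov's extension theorem -/

namespace FinAddProb

theorem exists_measure {S : Type*} {m : MeasurableSpace S}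
    {p : FinAddProb (SetAlg.ofMeasurableSpace m)} (hp : p.IsSigmaAdditive) :
    ∃ μ : Measure S, IsProbabilityMeasure μ ∧
      ∀ A, MeasurableSet A → μ A = ENNReal.ofReal (p A) := by
  let μ : Measure S := Measure.ofMeasurable (fun A _ => ENNReal.ofReal (p A)) (by simp [p.empty])
    fun A hA hd => by
      have h := hp A hA hd (MeasurableSet.iUnion hA)
      rw [← h.tsum_eq, ENNReal.ofReal_tsum_of_nonneg (fun k => p.nonneg _) h.summable]
  have hμ : ∀ A, MeasurableSet A → μ A = ENNReal.ofReal (p A) := fun A hA =>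
    Measure.ofMeasurable_apply A hA
  exact ⟨μ, ⟨by rw [hμ _ .univ, p.univ', ENNReal.ofReal_one]⟩, hμ⟩

open Classical in
/-- A probability measure, seen as a finitely additive one. -/
noncomputable def ofMeasure {S : Type*} {m : MeasurableSpace S} (μ : Measure S)
    [IsProbabilityMeasure μ] : FinAddProb (SetAlg.ofMeasurableSpace m) where
  toFun A := if MeasurableSet A then μ.real A else 0
  nonneg' A _ := by split_ifs <;> positivity
  univ' := by simp
  union' A hA B hB hAB := by
    change MeasurableSet A at hA
    change MeasurableSet B at hB
    simp only [hA, hB, hA.union hB, if_true]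
    exact measureReal_union hAB hB
  off' A hA := if_neg hA

theorem ofMeasure_apply {S : Type*} {m : MeasurableSpace S} (μ : Measure S)
    [IsProbabilityMeasure μ] {A : Set S} (hA : MeasurableSet A) : ofMeasure μ A = μ.real A :=
  if_pos hA

theorem isSigmaAdditive_ofMeasure {S : Type*} {m : MeasurableSpace S} (μ : Measure S)
    [IsProbabilityMeasure μ] : (ofMeasure μ).IsSigmaAdditive := by
  intro A hA hd hU
  rw [ofMeasure_apply μ hU]
  simp only [fun k => ofMeasure_apply μ (hA k)]
  have h := measure_iUnion (μ := μ) hd hA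
  have h1 : Summable fun k => μ.real (A k) :=
    ENNReal.summable_toReal (h ▸ measure_ne_top μ _)
  convert h1.hasSum
  rw [measureReal_def, h, ENNReal.tsum_toReal_eq fun k => measure_ne_top μ _]
  rfl

theorem IsSigmaAdditive.map {S S₁ : Type*} {m : MeasurableSpace S} {ℬ : SetAlg S₁} {X : S → S₁}
    {p : FinAddProb (SetAlg.ofMeasurableSpace m)} (hp : p.IsSigmaAdditive)
    (hX : IsMeasMap (SetAlg.ofMeasurableSpace m) ℬ X) : (FinAddProb.map X hX p).IsSigmaAdditive := by
  intro A hA hd hU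
  rw [map_apply hX p hU, preimage_iUnion]
  simp only [fun k => map_apply hX p (hA k)]
  exact hp _ (fun k => hX _ (hA k)) (fun i j hij => (hd hij).preimage X)
    (MeasurableSet.iUnion fun k => hX _ (hA k))

end FinAddProb

/-- Points `x n` that meet more and more of a sequence of cylinders with compact bases have, along
an ultrafilter, a coordinatewise limit on the coordinates that matter; it lies in all cylinders. -/
theorem nonempty_iInter_cylinder {ι : Type*} {E : ι → Type*} [∀ i, TopologicalSpace (E i)]
    [∀ i, T2Space (E i)]
    (s : ℕ → Finset ι) (K : ∀ n, Set (∀ i : s n, E i)) (hK : ∀ n, IsCompact (K n))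
    (h : ∀ n, (⋂ k ≤ n, cylinder (s k) (K k)).Nonempty) :
    (⋂ n, cylinder (s n) (K n)).Nonempty := by
  classical
  choose x hx using h
  have hx' : ∀ k n, k ≤ n → (s k).restrict (x n) ∈ K k := fun k n hkn => mem_iInter₂.1 (hx n) k hkn
  let 𝒰 : Ultrafilter ℕ := Ultrafilter.of atTop
  have hlim : ∀ k, ∃ z ∈ K k, Tendsto (fun n => (s k).restrict (x n)) 𝒰 (𝓝 z) := by
    intro k
    refine (hK k).ultrafilter_le_nhds (𝒰.map fun n => (s k).restrict (x n)) ?_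
    rw [le_principal_iff]
    exact Ultrafilter.of_le atTop ((eventually_ge_atTop k).mono (hx' k))
  choose z hz hzlim using hlim
  refine ⟨fun i => if hi : ∃ k, i ∈ s k then z hi.choose ⟨i, hi.choose_spec⟩ else x 0 i,
    mem_iInter.2 fun k => ?_⟩
  rw [mem_cylinder]
  convert hz k using 1
  funext i
  have hi : ∃ k, (i : ι) ∈ s k := ⟨k, i.2⟩
  simp only [Finset.restrict, hi, dif_pos]
  exact tendsto_nhds_unique (tendsto_pi_nhds.1 (hzlim hi.choose) ⟨i, hi.choose_spec⟩)
    (tendsto_pi_nhds.1 (hzlim k) i)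

namespace FinAddProb

variable {ι : Type*} {E : ι → Type*} [m : ∀ i, MeasurableSpace (E i)]

theorem isMeasMap_restrict (I : Finset ι) :
    IsMeasMap (SetAlg.ofMeasurableSpace (MeasurableSpace.pi (X := E)))
      (SetAlg.ofMeasurableSpace MeasurableSpace.pi) I.restrict :=
  fun _ hF => I.measurable_restrict hF

variable [∀ i, TopologicalSpace (E i)] [∀ i, PolishSpace (E i)] [∀ i, BorelSpace (E i)]
  {p : FinAddProb (SetAlg.ofMeasurableSpace (MeasurableSpace.pi (X := E)))}

/-- Continuity at `∅` on cylinders: replacing the bases by compact sets of almost the same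
measure, a decreasing sequence of cylinders whose measures stay above some `ε` has a common
point. -/
theorem tendsto_zero_of_cylinders
    (hp : ∀ I : Finset ι, (map _ (isMeasMap_restrict I) p).IsSigmaAdditive)
    {A : ℕ → Set (∀ i, E i)} (hA : ∀ n, A n ∈ measurableCylinders E) (hanti : Antitone A)
    (hempty : ⋂ n, A n = ∅) : Tendsto (fun n => p (A n)) atTop (𝓝 0) := by
  have hAm : ∀ n, MeasurableSet (A n) := fun n => .of_mem_measurableCylinders (hA n)
  rw [Metric.tendsto_atTop]
  intro ε hε
  suffices ∃ n, p (A n) < ε by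
    obtain ⟨n, hn⟩ := this
    refine ⟨n, fun k hk => ?_⟩
    rw [Real.dist_eq, sub_zero, abs_of_nonneg (p.nonneg _)]
    exact (p.mono (hAm k) (hAm n) (hanti hk)).trans_lt hn
  obtain ⟨δ, hδ, c, hδc, hcε⟩ := posSumOfEncodable (half_pos hε) ℕ
  have hcyl : ∀ n, ∃ (s : Finset ι) (S K : Set (∀ i : s, E i)), A n = cylinder s S ∧ K ⊆ S ∧
      IsCompact K ∧ MeasurableSet (cylinder s K) ∧ p (A n \ cylinder s K) ≤ δ n := by
    intro n
    obtain ⟨s, S, hS, hAn⟩ := (mem_measurableCylinders _).1 (hA n)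
    obtain ⟨μ, _, hμ⟩ := exists_measure (hp s)
    obtain ⟨K, hKS, hK, hKδ⟩ := hS.exists_isCompact_sdiff_lt (measure_ne_top μ S)
      (ε := ENNReal.ofReal (δ n)) (by simpa using hδ n)
    have hKm := hK.measurableSet
    refine ⟨s, S, K, hAn, hKS, hK, hKm.cylinder, ?_⟩
    rw [hμ _ (hS.diff hKm), ENNReal.ofReal_lt_ofReal_iff (hδ n), map_apply _ _ (hS.diff hKm)] at hKδ
    rw [hAn]
    exact hKδ.le
  choose s S K hAS hKS hK hKm hKδ using hcyl
  let D : ℕ → Set (∀ i, E i) := fun n => ⋂ k ≤ n, cylinder (s k) (K k)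
  have hDm : ∀ n, MeasurableSet (D n) := fun n =>
    MeasurableSet.iInter fun k => MeasurableSet.iInter fun _ => hKm k
  have hD : ∀ n, p (A n \ D n) ≤ ∑ k ∈ Finset.range (n + 1), δ k := by
    intro n
    induction n with
    | zero => simpa [D] using hKδ 0
    | succ n ih =>
      rw [Finset.sum_range_succ]
      refine le_trans ?_ (add_le_add ih (hKδ (n + 1)))
      refine le_trans (p.mono ((hAm _).diff (hDm _))
        (((hAm n).diff (hDm n)).union ((hAm (n + 1)).diff (hKm (n + 1)))) ?_)
        (p.union_le ((hAm _).diff (hDm _)) ((hAm _).diff (hKm _)))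
      rintro x ⟨hxA, hxD⟩
      by_cases hxK : x ∈ cylinder (s (n + 1)) (K (n + 1))
      · refine Or.inl ⟨hanti n.le_succ hxA, fun hx => hxD ?_⟩
        refine mem_iInter₂.2 fun k hk => ?_
        rcases Nat.le_succ_iff.1 hk with hk | rfl
        · exact mem_iInter₂.1 hx k hk
        · exact hxK
      · exact Or.inr ⟨hxA, hxK⟩
  by_contra! hge
  have hne : ∀ n, (D n).Nonempty := by
    intro n
    rw [nonempty_iff_ne_empty]
    intro h
    have h1 := hD n
    rw [h, sdiff_empty] at h1
    exact (hge n).not_gt ((h1.trans (sum_le_hasSum _ (fun k _ => (hδ k).le) hδc)).trans_lt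
      (by linarith))
  obtain ⟨x, hx⟩ := nonempty_iInter_cylinder s K hK hne
  have : x ∈ ⋂ n, A n := mem_iInter.2 fun n => by
    rw [hAS n]
    exact hKS n (mem_iInter.1 hx n)
  simp [hempty] at this

/-- Kolmogorov's extension theorem: if the finite-dimensional laws of a finitely additive
probability measure on a product of Polish spaces are σ-additive, they are the finite-dimensional
laws of a σ-additive one. -/
theorem exists_isSigmaAdditive_eq_on_cylinders
    (hp : ∀ I : Finset ι, (map _ (isMeasMap_restrict I) p).IsSigmaAdditive) :
    ∃ q : FinAddProb (SetAlg.ofMeasurableSpace (MeasurableSpace.pi (X := E))),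
      q.IsSigmaAdditive ∧ ∀ A ∈ measurableCylinders E, q A = p A := by
  have hm : ∀ A ∈ measurableCylinders E, MeasurableSet A := fun A hA =>
    .of_mem_measurableCylinders hA
  let c : AddContent ℝ≥0∞ (measurableCylinders E) :=
    isSetRing_measurableCylinders.addContent_of_union (fun A => ENNReal.ofReal (p A))
      (by simp [p.empty]) fun {A B} hA hB hAB => by
        rw [p.union' A (hm A hA) B (hm B hB) hAB, ENNReal.ofReal_add (p.nonneg _) (p.nonneg _)]
  have hc : c.IsSigmaSubadditive := by
    refine isSigmaSubadditive_of_addContent_iUnion_eq_tsum isSetRing_measurableCylinders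
      fun f hf hU hd => addContent_iUnion_eq_sum_of_tendsto_zero isSetRing_measurableCylinders c
        (fun A _ => ENNReal.ofReal_ne_top) (fun A hA hanti hempty => ?_) hf hU hd
    have h := ENNReal.tendsto_ofReal (tendsto_zero_of_cylinders hp hA hanti hempty)
    rw [ENNReal.ofReal_zero] at h
    exact h
  let μ := c.measure isSetSemiring_measurableCylinders generateFrom_measurableCylinders.ge hc
  have hμ : ∀ A ∈ measurableCylinders E, μ A = ENNReal.ofReal (p A) := fun A hA =>
    c.measure_eq isSetSemiring_measurableCylinders generateFrom_measurableCylinders.symm hc hA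
  have : IsProbabilityMeasure μ :=
    ⟨by rw [hμ _ (univ_mem_measurableCylinders E), p.univ', ENNReal.ofReal_one]⟩
  refine ⟨ofMeasure μ, isSigmaAdditive_ofMeasure μ, fun A hA => ?_⟩
  rw [ofMeasure_apply μ (hm A hA), measureReal_def, hμ A hA, ENNReal.toReal_ofReal (p.nonneg _)]

end FinAddProb

/-! ### Systems of σ-additive measures on the real line -/

theorem sigmaPow_borel (n : ℕ) :
    SetAlg.ofMeasurableSpace (borel (Fin n → ℝ)) = SetAlg.sigmaPow (borel ℝ) n := by
  have h1 : borel (Fin n → ℝ) = MeasurableSpace.pi := (BorelSpace.measurable_eq).symm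
  have h2 : borel ℝ = Real.measurableSpace := (BorelSpace.measurable_eq).symm
  rw [SetAlg.sigmaPow, h1, h2]

theorem isMeasMap_real_coordinates {T : Type*} (n : ℕ) (t : Fin n ↪ T) :
    IsMeasMap (SetAlg.ofMeasurableSpace (MeasurableSpace.pi (X := fun _ : ULift T => ℝ)))
      (SetAlg.ofMeasurableSpace (borel (Fin n → ℝ))) fun ω i => ω ⟨t i⟩ := by
  intro F hF
  have hF' : MeasurableSet F := by
    rw [BorelSpace.measurable_eq (α := Fin n → ℝ)]
    exact hF
  have h : Measurable fun (ω : ULift T → ℝ) (i : Fin n) => ω ⟨t i⟩ := by fun_prop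
  exact h hF'

theorem preimage_coordinates_mem_measurableCylinders {T : Type*} {n : ℕ} (t : Fin n ↪ T)
    {F : Set (Fin n → ℝ)} (hF : MeasurableSet F) :
    (fun (ω : ULift T → ℝ) i => ω ⟨t i⟩) ⁻¹' F ∈ measurableCylinders fun _ : ULift T => ℝ := by
  classical
  let t' : Fin n → ULift T := fun i => ⟨t i⟩
  let I : Finset (ULift T) := Finset.univ.image t'
  have hI : ∀ i, t' i ∈ I := fun i => Finset.mem_image_of_mem _ (Finset.mem_univ i)
  have h : Measurable fun (y : I → ℝ) i => y ⟨t' i, hI i⟩ := by fun_prop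
  exact (mem_measurableCylinders _).2 ⟨I, _, h hF, rfl⟩

/-- A finitely additive measure on `ℝ ^ T` whose laws on nonempty tuples are σ-additive has
σ-additive restrictions to all finite sets of coordinates. -/
theorem isSigmaAdditive_map_restrict {T : Type*} [Nonempty T]
    {p : FinAddProb (SetAlg.ofMeasurableSpace (MeasurableSpace.pi (X := fun _ : ULift T => ℝ)))}
    (hp : ∀ (n : ℕ) (t : Fin n ↪ T), 0 < n →
      (FinAddProb.map _ (isMeasMap_real_coordinates n t) p).IsSigmaAdditive)
    (I : Finset (ULift T)) :
    (FinAddProb.map _ (FinAddProb.isMeasMap_restrict I) p).IsSigmaAdditive := by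
  classical
  -- a further coordinate is added because `I` may be empty
  obtain ⟨n, t, ht⟩ := exists_tuple_range_eq
    (((I.image ULift.down).finite_toSet).insert (Classical.arbitrary T))
  obtain ⟨j₀, -⟩ : Classical.arbitrary T ∈ range t := ht ▸ mem_insert _ _
  have hI : ∀ i : I, ∃ j, t j = (i : ULift T).down := fun i => by
    have : (i : ULift T).down ∈ range t := ht ▸ mem_insert_of_mem _
      (Finset.mem_coe.2 (Finset.mem_image_of_mem _ i.2))
    exact this
  choose g hg using hI
  have hgm : IsMeasMap (SetAlg.ofMeasurableSpace (borel (Fin n → ℝ)))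
      (SetAlg.ofMeasurableSpace MeasurableSpace.pi) fun (y : Fin n → ℝ) (i : I) => y (g i) := by
    intro F hF
    have h : Measurable fun (y : Fin n → ℝ) (i : I) => y (g i) := by fun_prop
    rw [← BorelSpace.measurable_eq (α := Fin n → ℝ)]
    exact h hF
  convert (hp n t j₀.pos).map hgm using 1
  refine FinAddProb.eq_of_eq_on_sets fun F hF => ?_
  rw [FinAddProb.map_apply _ _ hF, FinAddProb.map_apply _ _ hF,
    FinAddProb.map_apply _ _ (hgm F hF)]
  refine congrArg p ?_
  ext ω
  simp only [mem_preimage, hg]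
  rfl

namespace FDSystem

theorem exists_isRepresentedBy_sigmaAdditive {T : Type u} [Nonempty T]
    (V : FDSystem T (fun n => SetAlg.ofMeasurableSpace (borel (Fin n → ℝ))))
    (hV : V.IsNonemptyClosed)
    (hσ : ∀ (n : ℕ) (t : Fin n ↪ T), 0 < n → ∀ q ∈ V n t, q.IsSigmaAdditive)
    (hperm : V.PermConsistent) (hmarg : V.MargConsistent) :
    ∃ (Ω : Type (max u w)) (𝒜 : MeasurableSpace Ω)
      (P : Set (FinAddProb (SetAlg.ofMeasurableSpace 𝒜))) (X : T → Ω → ℝ),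
      IsWeakStarClosed P ∧ V.IsRepresentedBy X P ∧
      ∃ Pσ : Set (FinAddProb (SetAlg.ofMeasurableSpace 𝒜)),
        IsWeakStarClosedIn {p | p.IsSigmaAdditive} Pσ ∧ V.IsRepresentedBy X Pσ := by
  have h𝒢 : HasMeasurableReindexing fun n => SetAlg.ofMeasurableSpace (borel (Fin n → ℝ)) := by
    simp only [sigmaPow_borel]
    exact SetAlg.hasMeasurableReindexing_sigmaPow _
  have hX := isMeasMap_real_coordinates.{u, w} (T := T)
  have hclosed := isClosed_admissible hV (X := fun t (ω : ULift.{w} T → ℝ) => ω ⟨t⟩) hX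
  have hrep := isRepresentedBy_admissible h𝒢 hV hperm hmarg
    (X := fun t (ω : ULift.{w} T → ℝ) => ω ⟨t⟩) hX surjective_coordinates
  refine ⟨ULift.{w} T → ℝ, MeasurableSpace.pi, V.admissible hX, fun t ω => ω ⟨t⟩,
    hclosed.isWeakStarClosed, hrep, _, hclosed.isWeakStarClosedIn _, fun n t hn => ⟨hX n t, ?_⟩⟩
  refine Subset.antisymm ?_ fun v hv => ?_
  · rintro _ ⟨p, hp, rfl⟩
    exact hp.1 n t hn
  obtain ⟨_, himage⟩ := hrep n t hn
  rw [← himage] at hv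
  obtain ⟨p, hp, rfl⟩ := hv
  obtain ⟨q, hq, hqp⟩ := FinAddProb.exists_isSigmaAdditive_eq_on_cylinders
    (isSigmaAdditive_map_restrict fun k s hk => hσ k s hk _ (hp k s hk))
  have hmap : ∀ (k : ℕ) (s : Fin k ↪ T),
      FinAddProb.map _ (hX k s) q = FinAddProb.map _ (hX k s) p := by
    intro k s
    refine FinAddProb.eq_of_eq_on_sets fun F hF => ?_
    rw [FinAddProb.map_apply _ _ hF, FinAddProb.map_apply _ _ hF]
    refine hqp _ (preimage_coordinates_mem_measurableCylinders s ?_)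
    rw [BorelSpace.measurable_eq (α := Fin k → ℝ)]
    exact hF
  exact ⟨q, ⟨fun k s hk => (hmap k s).symm ▸ hp k s hk, hq⟩, hmap n t⟩

end FDSystem

/-! ### The representation theorem -/

theorem theorem1 {T : Type u} [Nonempty T] :
    -- an algebra `𝓕` on `Y`, and the product algebras on `Y ^ n`
    (∀ (Y : Type v) [Nonempty Y] (𝓕 : SetAlg Y) (V : FDSystem T (fun n => 𝓕.pow n)),
      V.IsNonemptyClosed →
      ((V.PermConsistent ∧ V.MargConsistent) ↔
        ∃ (Ω : Type (max u v w)) (𝒜 : MeasurableSpace Ω)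
          (P : Set (FinAddProb (SetAlg.ofMeasurableSpace 𝒜))) (X : T → Ω → Y),
          IsWeakStarClosed P ∧ V.IsRepresentedBy X P)) ∧
    -- a σ-algebra on `Y`, and the product σ-algebras on `Y ^ n`
    (∀ (Y : Type v) [Nonempty Y] (m : MeasurableSpace Y)
        (V : FDSystem T (fun n => SetAlg.sigmaPow m n)),
      V.IsNonemptyClosed →
      ((V.PermConsistent ∧ V.MargConsistent) ↔
        ∃ (Ω : Type (max u v w)) (𝒜 : MeasurableSpace Ω)
          (P : Set (FinAddProb (SetAlg.ofMeasurableSpace 𝒜))) (X : T → Ω → Y),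
          IsWeakStarClosed P ∧ V.IsRepresentedBy X P)) ∧
    -- σ-additive measures on the Borel sets of `ℝ ^ n`
    (∀ V : FDSystem T (fun n => SetAlg.ofMeasurableSpace (borel (Fin n → ℝ))),
      V.IsNonemptyClosed →
      (∀ (n : ℕ) (t : Fin n ↪ T), 0 < n → ∀ q ∈ V n t, q.IsSigmaAdditive) →
      V.PermConsistent → V.MargConsistent →
        ∃ (Ω : Type (max u w)) (𝒜 : MeasurableSpace Ω)
          (P : Set (FinAddProb (SetAlg.ofMeasurableSpace 𝒜))) (X : T → Ω → ℝ),
          IsWeakStarClosed P ∧ V.IsRepresentedBy X P ∧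
          ∃ Pσ : Set (FinAddProb (SetAlg.ofMeasurableSpace 𝒜)),
            IsWeakStarClosedIn {p | p.IsSigmaAdditive} Pσ ∧ V.IsRepresentedBy X Pσ) := by
  refine ⟨fun Y _ 𝓕 V hV => ?_, fun Y _ m V hV => ?_, fun V hV hσ hperm hmarg => ?_⟩
  · exact FDSystem.consistent_iff_exists_isRepresentedBy.{u, v, w}
      𝓕.hasMeasurableReindexing_pow V hV
  · exact FDSystem.consistent_iff_exists_isRepresentedBy.{u, v, w}
      (SetAlg.hasMeasurableReindexing_sigmaPow m) V hV
  · exact FDSystem.exists_isRepresentedBy_sigmaAdditive.{u, w} V hV hσ hperm hmarg
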